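/- **Theorem 3.** For points of $\mathbb{N}^2$, say that $p$ dominates $q$ if each coordinate of $p$ is at least the corresponding coordinate of $q$. In the word RAM model, for every constant $\varepsilon>0$ there is a linear-space data structure that approximately answers two-dimensional dominance counting queries on the $n\times n$ grid up to a constant factor $1\pm\varepsilon$ in $O(\log\log n)$ time. Precisely: for every $\varepsilon>0$ there are a word RAM query program and constants $C,c$, all depending only on $\varepsilon$, such that for every $n$, every word size $w\ge\lfloor\log_2 n\rfloor+c$ and every set $P\subseteq\{1,\dots,n\}^2$ of at most $n$ points there is a data structure of at most $Cn$ words of $w$ bits, such that for every query point $q\in\{1,\dots,n\}^2$ the program, given $q$ and access to these words only (besides its constantly many registers), halts after at most $C(\log_2\log_2 n+1)$ steps (logarithms rounded down, and read as $0$ for arguments smaller than $1$), leaves the data structure unchanged, and outputs an integer $k'$ with $$(1-\varepsilon)\,k\;\le\; k'\;\le\;(1+\varepsilon)\,k,$$ where $k$ is the number of points of $P$ that dominate $q$. In particular $k'=0$ if $k=0$. -/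

import Mathlib

/-! ## Word RAM with unit cost instructions

All registers and memory cells hold words of `w` bits; arithmetic is unsigned and modulo `2 ^ w`. -/

namespace WordRAM

/-- The binary operations on words that the machine performs in one step. -/
inductive BinOp where
  | add
  | sub
  | mul
  | div
  | mod
  | and
  | or
  | xor
  | shl
  | shr

/-- The value of a binary operation on `w`-bit words. Division and remainder are those of
unsigned integers; a shift amount is read as an unsigned integer. -/
def BinOp.eval {w : ℕ} : BinOp → BitVec w → BitVec w → BitVec w
  | .add, x, y => x + y
  | .sub, x, y => x - y
  | .mul, x, y => x * y
  | .div, x, y => x / y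
  | .mod, x, y => x % y
  | .and, x, y => x &&& y
  | .or, x, y => x ||| y
  | .xor, x, y => x ^^^ y
  | .shl, x, y => x <<< y.toNat
  | .shr, x, y => x >>> y.toNat

/-- Instructions. The arguments `d`, `a`, `b` are names of registers and `t` is a position in the
program. A program is a finite list of instructions, so it uses only finitely many registers. -/
inductive Instr where
  /-- `r_d := v` (modulo `2 ^ w`) -/
  | const (d v : ℕ)
  /-- `r_d := r_a` -/
  | move (d a : ℕ)
  /-- `r_d := r_a o r_b` -/
  | op (o : BinOp) (d a b : ℕ)
  /-- `r_d := M[r_a]` -/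
  | load (d a : ℕ)
  /-- `M[r_a] := r_b` -/
  | store (a b : ℕ)
  /-- go to `t` -/
  | jump (t : ℕ)
  /-- if `r_a = r_b` then go to `t` -/
  | jumpEq (a b t : ℕ)
  /-- if `r_a < r_b` (as unsigned integers) then go to `t` -/
  | jumpLt (a b t : ℕ)
  /-- stop -/
  | halt

/-- A configuration of a machine with word size `w` and a memory of `S` words. -/
@[ext]
structure Config (w S : ℕ) where
  /-- the position of the next instruction -/
  pc : ℕ
  /-- the contents of the registers -/
  reg : ℕ → BitVec w
  /-- the contents of the memory -/
  mem : Fin S → BitVec w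

variable {w S : ℕ}

/-- Write the word `v` to register `d` and go on to the next instruction. -/
def Config.write (σ : Config w S) (d : ℕ) (v : BitVec w) : Config w S :=
  { σ with pc := σ.pc + 1, reg := Function.update σ.reg d v }

/-- The effect of a single instruction. There is no next configuration after `halt`, nor after an
access to an address outside of the `S` words of memory. -/
def Instr.exec (σ : Config w S) : Instr → Option (Config w S)
  | .const d v => some (σ.write d (BitVec.ofNat w v))
  | .move d a => some (σ.write d (σ.reg a))
  | .op o d a b => some (σ.write d (o.eval (σ.reg a) (σ.reg b)))
  | .load d a =>
      if h : (σ.reg a).toNat < S then some (σ.write d (σ.mem ⟨(σ.reg a).toNat, h⟩)) else none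
  | .store a b =>
      if h : (σ.reg a).toNat < S then
        some { σ with
          pc := σ.pc + 1
          mem := Function.update σ.mem ⟨(σ.reg a).toNat, h⟩ (σ.reg b) }
      else none
  | .jump t => some { σ with pc := t }
  | .jumpEq a b t => some { σ with pc := if σ.reg a = σ.reg b then t else σ.pc + 1 }
  | .jumpLt a b t =>
      some { σ with pc := if (σ.reg a).toNat < (σ.reg b).toNat then t else σ.pc + 1 }
  | .halt => none

/-- One step of a program: execute the instruction at the current position. -/
def step (prog : List Instr) (σ : Config w S) : Option (Config w S) :=
  prog[σ.pc]?.bind (Instr.exec σ)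

/-- The configuration after exactly `t` steps, if all of them can be performed. -/
def run (prog : List Instr) : ℕ → Config w S → Option (Config w S)
  | 0, σ => some σ
  | t + 1, σ => (step prog σ).bind (run prog t)

/-- Started in `σ`, the program arrives after at most `T` steps at a `halt` instruction, in the
configuration `τ`. -/
def HaltsWithin (prog : List Instr) (T : ℕ) (σ τ : Config w S) : Prop :=
  (∃ t ≤ T, run prog t σ = some τ) ∧ prog[τ.pc]? = some Instr.halt

/-- The initial configuration for a query `(x, y)` to the data structure stored in `mem`: the two
numbers are in the registers `0` and `1`, all other registers are `0`. -/
def queryConfig (mem : Fin S → BitVec w) (q : ℕ × ℕ) : Config w S where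
  pc := 0
  reg i := if i = 0 then BitVec.ofNat w q.1 else if i = 1 then BitVec.ofNat w q.2 else 0
  mem := mem

end WordRAM

/-! ## Dominance counting on the grid -/

/-- The `n × n` grid of points with integer coordinates between `1` and `n`. -/
def grid (n : ℕ) : Finset (ℕ × ℕ) :=
  Finset.Icc 1 n ×ˢ Finset.Icc 1 n

/-- `p` dominates `q`: each coordinate of `p` is at least the corresponding coordinate of `q`. -/
def Dominates (p q : ℕ × ℕ) : Prop :=
  q.1 ≤ p.1 ∧ q.2 ≤ p.2

instance (p q : ℕ × ℕ) : Decidable (Dominates p q) :=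
  inferInstanceAs (Decidable (q.1 ≤ p.1 ∧ q.2 ≤ p.2))

/-- The number of points of `P` that dominate `q`. -/
def dominanceCount (P : Finset (ℕ × ℕ)) (q : ℕ × ℕ) : ℕ :=
  (P.filter fun p => Dominates p q).card

/-- `k'` approximates `k` up to the constant factor given by `ε`. -/
def ApproxCount (ε : ℝ) (k k' : ℕ) : Prop :=
  (1 - ε) * k ≤ k' ∧ (k' : ℝ) ≤ (1 + ε) * k

/-! ### Execution of programs. -/

namespace WordRAM

variable {w S : ℕ}

/-! For a level `k`, the heights where the count drops below `k` form a staircase over the columns.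
Only an approximation is stored: columns are grouped into blocks within which `pointsLeft` varies by
less than `s`, so moving `x` inside a block changes the count by less than `s`. One height per block
thus decides, up to an error below `s`, whether the count reaches `k`
(`le_dominanceCount_of_le_stairHeight`, `dominanceCount_lt_of_stairHeight_lt`).

Taking `s` to be the gap to the next level, with `K` levels per power of two, makes this error a
fraction O(1/K) of the level (`gap_add_gap_le`). A staircase with gap `s` needs about `n / s` words,
so the space is a geometric sum, O(Kn). There are O(K log n) levels, and binary search over them
takes O(log log n) steps for fixed `K`. -/

theorem run_add (prog : List Instr) (a b : ℕ) (σ : Config w S) :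
    run prog (a + b) σ = (run prog a σ).bind (run prog b) := by
  induction a generalizing σ with
  | zero => simp [run]
  | succ a ih =>
    rw [Nat.succ_add]
    simp only [run]
    cases step prog σ with
    | none => rfl
    | some σ' => simpa using ih σ'

theorem run_trans {prog : List Instr} {a b : ℕ} {σ τ υ : Config w S}
    (h₁ : run prog a σ = some τ) (h₂ : run prog b τ = some υ) :
    run prog (a + b) σ = some υ := by
  rw [run_add, h₁]; exact h₂

theorem run_cons {prog : List Instr} {t : ℕ} {σ σ' τ : Config w S} {i : Instr}
    (hi : prog[σ.pc]? = some i) (he : i.exec σ = some σ') (hr : run prog t σ' = some τ) :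
    run prog (t + 1) σ = some τ := by
  simp only [run, step, hi, Option.bind_some, he, hr]

theorem run_const {prog : List Instr} {t : ℕ} {σ τ : Config w S} {d v : ℕ}
    (hi : prog[σ.pc]? = some (.const d v))
    (hr : run prog t (σ.write d (BitVec.ofNat w v)) = some τ) :
    run prog (t + 1) σ = some τ :=
  run_cons hi rfl hr

theorem run_move {prog : List Instr} {t : ℕ} {σ τ : Config w S} {d a : ℕ} {v : BitVec w}
    (hi : prog[σ.pc]? = some (.move d a)) (hv : σ.reg a = v)
    (hr : run prog t (σ.write d v) = some τ) :
    run prog (t + 1) σ = some τ :=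
  run_cons hi rfl (hv ▸ hr)

theorem run_op {prog : List Instr} {t : ℕ} {σ τ : Config w S} {o : BinOp} {d a b : ℕ}
    {v : BitVec w} (hi : prog[σ.pc]? = some (.op o d a b))
    (hv : o.eval (σ.reg a) (σ.reg b) = v)
    (hr : run prog t (σ.write d v) = some τ) :
    run prog (t + 1) σ = some τ :=
  run_cons hi rfl (hv ▸ hr)

theorem run_jump {prog : List Instr} {t : ℕ} {σ τ : Config w S} {l : ℕ}
    (hi : prog[σ.pc]? = some (.jump l)) (hr : run prog t { σ with pc := l } = some τ) :
    run prog (t + 1) σ = some τ :=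
  run_cons hi rfl hr

/-- The memory cell with address `a` exists and holds the number `v`. -/
def Cell (mem : Fin S → BitVec w) (a v : ℕ) : Prop :=
  a < 2 ^ w ∧ v < 2 ^ w ∧ ∃ h : a < S, mem ⟨a, h⟩ = BitVec.ofNat w v

theorem run_load {prog : List Instr} {t : ℕ} {σ τ : Config w S} {d r a v : ℕ}
    (hi : prog[σ.pc]? = some (.load d r)) (ha : σ.reg r = BitVec.ofNat w a)
    (hc : Cell σ.mem a v)
    (hr : run prog t (σ.write d (BitVec.ofNat w v)) = some τ) :
    run prog (t + 1) σ = some τ := by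
  obtain ⟨haw, -, hS, hv⟩ := hc
  have hn : (σ.reg r).toNat = a := by
    rw [ha, BitVec.toNat_ofNat, Nat.mod_eq_of_lt haw]
  refine run_cons hi ?_ hr
  simp [Instr.exec, hn, hS, hv]

/-! ### The binary search program and its correctness. -/

/-- Binary search over an array of pointers, between the addresses stored in the cells `0` and `1`.
The pointer at `mid` leads to a row `s, k, g₀, g₁, …`; with `r` the content of the cell of the first
coordinate `x` of the query, the search goes up if `g_(r / s)` is at least the second coordinate
`y`. The output is the entry `k` of the row where the search ends. -/
def searchProg : List Instr :=
  [.const 3 1,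
   .op .add 2 0 3,
   .load 2 2,
   .load 4 6,
   .load 5 3,
   .const 7 2,
   .op .sub 8 5 4,
   .jumpEq 8 3 21,
   .op .add 8 4 5,
   .op .shr 8 8 3,
   .load 9 8,
   .load 10 9,
   .op .div 10 2 10,
   .op .add 9 9 10,
   .op .add 9 9 7,
   .load 10 9,
   .jumpLt 10 1 19,
   .move 4 8,
   .jump 6,
   .move 5 8,
   .jump 6,
   .load 9 4,
   .op .add 9 9 3,
   .load 0 9,
   .halt]

/-- The state of `searchProg` at the start of its loop. -/
structure SearchState (mem : Fin S → BitVec w) (y r lo hi : ℕ) (σ : Config w S) : Prop where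
  pc : σ.pc = 6
  mem : σ.mem = mem
  reg_y : σ.reg 1 = BitVec.ofNat w y
  reg_r : σ.reg 2 = BitVec.ofNat w r
  reg_one : σ.reg 3 = BitVec.ofNat w 1
  reg_lo : σ.reg 4 = BitVec.ofNat w lo
  reg_hi : σ.reg 5 = BitVec.ofNat w hi
  reg_two : σ.reg 7 = BitVec.ofNat w 2

theorem ofNat_sub_ofNat {a b : ℕ} (h : b ≤ a) :
    BitVec.ofNat w a - BitVec.ofNat w b = BitVec.ofNat w (a - b) := by
  have : BitVec.ofNat w a = BitVec.ofNat w (a - b) + BitVec.ofNat w b := by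
    rw [← BitVec.ofNat_add, Nat.sub_add_cancel h]
  rw [this, BitVec.add_sub_cancel]

theorem ofNat_div_ofNat {a b : ℕ} (ha : a < 2 ^ w) (hb : b < 2 ^ w) :
    BitVec.ofNat w a / BitVec.ofNat w b = BitVec.ofNat w (a / b) := by
  apply BitVec.eq_of_toNat_eq
  simp only [BitVec.toNat_udiv, BitVec.toNat_ofNat, Nat.mod_eq_of_lt ha, Nat.mod_eq_of_lt hb]
  rw [Nat.mod_eq_of_lt ((Nat.div_le_self _ _).trans_lt ha)]

theorem ofNat_shr_one {a : ℕ} (ha : a < 2 ^ w) (hw : 1 < 2 ^ w) :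
    BitVec.ofNat w a >>> (BitVec.ofNat w 1).toNat = BitVec.ofNat w (a / 2) := by
  apply BitVec.eq_of_toNat_eq
  rw [BitVec.toNat_ushiftRight, BitVec.toNat_ofNat, BitVec.toNat_ofNat, BitVec.toNat_ofNat,
    Nat.mod_eq_of_lt ha, Nat.mod_eq_of_lt hw, Nat.shiftRight_one,
    Nat.mod_eq_of_lt ((Nat.div_le_self _ _).trans_lt ha)]

theorem ofNat_inj {a b : ℕ} (ha : a < 2 ^ w) (hb : b < 2 ^ w) :
    BitVec.ofNat w a = BitVec.ofNat w b ↔ a = b := by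
  rw [← BitVec.toNat_inj, BitVec.toNat_ofNat, BitVec.toNat_ofNat, Nat.mod_eq_of_lt ha,
    Nat.mod_eq_of_lt hb]

theorem searchProg_iterate {mem : Fin S → BitVec w} {y r lo hi p s g : ℕ} {σ : Config w S}
    (hσ : SearchState mem y r lo hi σ) (hlt : lo + 1 < hi) (hsum : lo + hi < 2 ^ w)
    (hy : y < 2 ^ w) (hr : r < 2 ^ w)
    (hp : Cell mem ((lo + hi) / 2) p) (hs : Cell mem p s) (hg : Cell mem (p + r / s + 2) g) :
    ∃ τ, run searchProg 13 σ = some τ ∧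
      (g < y → SearchState mem y r lo ((lo + hi) / 2) τ) ∧
      (y ≤ g → SearchState mem y r ((lo + hi) / 2) hi τ) := by
  obtain ⟨pc, reg, mem'⟩ := σ
  obtain ⟨rfl, rfl, h1, h2, h3, h4, h5, h7⟩ := hσ
  simp only at h1 h2 h3 h4 h5 h7
  have hgw := hg.2.1
  have hw1 : 1 < 2 ^ w := by omega
  have hne : ¬ BitVec.ofNat w (hi - lo) = BitVec.ofNat w 1 := by
    rw [ofNat_inj (by omega) hw1]; omega
  -- Both outcomes share the first 11 instructions of the loop body. These are run once, up to the
  -- branch; the remaining two (a move and a jump) are handled per case.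
  suffices H : ∃ τ, (∀ υ, run searchProg 2 τ = some υ →
        run searchProg 13 ⟨6, reg, mem'⟩ = some υ) ∧
      τ.pc = (if g < y then 19 else 17) ∧ τ.mem = mem' ∧
      τ.reg 1 = BitVec.ofNat w y ∧ τ.reg 2 = BitVec.ofNat w r ∧ τ.reg 3 = BitVec.ofNat w 1 ∧
      τ.reg 4 = BitVec.ofNat w lo ∧ τ.reg 5 = BitVec.ofNat w hi ∧ τ.reg 7 = BitVec.ofNat w 2 ∧
      τ.reg 8 = BitVec.ofNat w ((lo + hi) / 2) by
    obtain ⟨⟨pc, reg', m⟩, hrun, hpc, hm, e1, e2, e3, e4, e5, e7, e8⟩ := H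
    simp only at hpc hm e1 e2 e3 e4 e5 e7 e8
    subst hm
    by_cases hgy : g < y
    · rw [if_pos hgy] at hpc
      subst hpc
      refine ⟨_, hrun _ (run_move rfl e8 (run_jump rfl rfl)), fun _ => ?_, fun h => by omega⟩
      constructor <;> simp [Config.write, *]
    · rw [if_neg hgy] at hpc
      subst hpc
      refine ⟨_, hrun _ (run_move rfl e8 (run_jump rfl rfl)), fun h => by omega, fun _ => ?_⟩
      constructor <;> simp [Config.write, *]
  -- The configuration after the comparison stays a metavariable, which unification fills in at the
  -- end of the symbolic run.
  apply Exists.intro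
  apply And.intro
  · intro υ hυ
    refine run_op rfl (v := BitVec.ofNat w (hi - lo)) ?_ ?_
    · simp only [BinOp.eval, h4, h5]; exact ofNat_sub_ofNat (by omega)
    refine run_cons (i := .jumpEq 8 3 21) rfl
      (σ' := ⟨8, Function.update reg 8 (BitVec.ofNat w (hi - lo)), mem'⟩) ?_ ?_
    · simp [Instr.exec, Config.write, h3, hne]
    refine run_op rfl (v := BitVec.ofNat w (lo + hi)) ?_ ?_
    · simp [BinOp.eval, h4, h5, BitVec.ofNat_add]
    refine run_op rfl (v := BitVec.ofNat w ((lo + hi) / 2)) ?_ ?_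
    · simp only [BinOp.eval, Config.write, Function.update_self]
      rw [Function.update_of_ne (by decide), Function.update_of_ne (by decide), h3]
      exact ofNat_shr_one hsum hw1
    refine run_load rfl (a := (lo + hi) / 2) (v := p) ?_ hp ?_
    · simp [Config.write]
    refine run_load rfl (a := p) (v := s) ?_ hs ?_
    · simp [Config.write]
    refine run_op rfl (v := BitVec.ofNat w (r / s)) ?_ ?_
    · simp only [BinOp.eval, Config.write, Function.update_self]
      simp only [Function.update_of_ne (show (2 : ℕ) ≠ 10 by decide),
        Function.update_of_ne (show (2 : ℕ) ≠ 9 by decide),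
        Function.update_of_ne (show (2 : ℕ) ≠ 8 by decide), h2]
      exact ofNat_div_ofNat hr hs.2.1
    refine run_op rfl (v := BitVec.ofNat w (p + r / s)) ?_ ?_
    · simp [BinOp.eval, Config.write, BitVec.ofNat_add]
    refine run_op rfl (v := BitVec.ofNat w (p + r / s + 2)) ?_ ?_
    · simp [BinOp.eval, Config.write, BitVec.ofNat_add, h7]
    refine run_load rfl (a := p + r / s + 2) (v := g) ?_ hg ?_
    · simp [Config.write]
    exact run_cons (i := .jumpLt 10 1 19) rfl rfl hυ
  · simp [Config.write, h1, h2, h3, h4, h5, h7, Nat.mod_eq_of_lt hy, Nat.mod_eq_of_lt hgw]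

/-- The invariant is that `lower` holds at the left end and `upper` at the right end. No
monotonicity is needed: each comparison re-establishes one of the two, even if approximate
staircases cross. Index `L` is a sentinel whose row is never read. -/
theorem searchProg_loop {mem : Fin S → BitVec w} {y r B L : ℕ} {lower upper : ℕ → Prop}
    (hB : 2 * (B + L) < 2 ^ w) (hy : y < 2 ^ w) (hr : r < 2 ^ w)
    (hrow : ∀ i < L, ∃ p s g, Cell mem (B + i) p ∧ Cell mem p s ∧ Cell mem (p + r / s + 2) g ∧
      (y ≤ g → lower i) ∧ (g < y → upper i)) (m : ℕ) :
    ∀ (i j : ℕ) (σ : Config w S), SearchState mem y r (B + i) (B + j) σ → i < j → j ≤ L →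
      j - i ≤ 2 ^ m → lower i → upper j →
      ∃ (τ : Config w S) (t l : ℕ), t ≤ 13 * m + 2 ∧ run searchProg t σ = some τ ∧
        τ.pc = 21 ∧ τ.mem = mem ∧ τ.reg 3 = BitVec.ofNat w 1 ∧ τ.reg 4 = BitVec.ofNat w (B + l) ∧
        l < L ∧ lower l ∧ upper (l + 1) := by
  induction m with
  | zero =>
    intro i j σ hσ hij hjL hm hi hj
    rw [pow_zero] at hm
    obtain rfl : j = i + 1 := by omega
    obtain ⟨pc, reg, mem'⟩ := σ
    obtain ⟨rfl, rfl, h1, h2, h3, h4, h5, h7⟩ := hσ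
    simp only at h1 h2 h3 h4 h5 h7
    refine ⟨⟨21, Function.update reg 8 (BitVec.ofNat w 1), mem'⟩, 2, i, le_rfl, ?_, rfl, rfl,
      ?_, ?_, hjL, hi, hj⟩
    · refine run_op rfl (v := BitVec.ofNat w 1) ?_ ?_
      · simp only [BinOp.eval, h4, h5]
        rw [ofNat_sub_ofNat (by omega)]
        congr 1
        omega
      refine run_cons (i := .jumpEq 8 3 21) rfl ?_ rfl
      simp [Instr.exec, Config.write, h3]
    · simp [h3]
    · simp [h4]
  | succ m ih =>
    intro i j σ hσ hij hjL hm hi hj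
    rw [pow_succ] at hm
    have hpos : 0 < 2 ^ m := by positivity
    by_cases hij1 : j = i + 1
    · obtain ⟨τ, t, l, ht, h⟩ := ih i j σ hσ hij hjL (by omega) hi hj
      exact ⟨τ, t, l, by omega, h⟩
    have hmid : (B + i + (B + j)) / 2 = B + (i + j) / 2 := by omega
    obtain ⟨p, s, g, hp, hs, hg, hlow, hup⟩ := hrow ((i + j) / 2) (by omega)
    obtain ⟨τ, hτ, hτ1, hτ2⟩ := searchProg_iterate hσ (by omega) (by omega) hy hr
      (hmid ▸ hp) hs hg
    rw [hmid] at hτ1 hτ2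
    by_cases hgy : g < y
    · obtain ⟨υ, t, l, ht, hrun, h⟩ := ih i ((i + j) / 2) τ (hτ1 hgy) (by omega) (by omega)
        (by omega) hi (hup hgy)
      exact ⟨υ, 13 + t, l, by omega, run_trans hτ hrun, h⟩
    · obtain ⟨υ, t, l, ht, hrun, h⟩ := ih ((i + j) / 2) j τ (hτ2 (by omega)) (by omega) (by omega)
        (by omega) (hlow (by omega)) hj
      exact ⟨υ, 13 + t, l, by omega, run_trans hτ hrun, h⟩

theorem searchProg_haltsWithin {mem : Fin S → BitVec w} {x y r B L m : ℕ}
    {lower upper : ℕ → Prop} {k : ℕ → ℕ}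
    (hB : 2 * (B + L) < 2 ^ w) (hy : y < 2 ^ w) (hr : r < 2 ^ w)
    (h0 : Cell mem 0 B) (h1 : Cell mem 1 (B + L)) (hx : Cell mem (x + 1) r)
    (hrow : ∀ i < L, ∃ p s g, Cell mem (B + i) p ∧ Cell mem p s ∧ Cell mem (p + 1) (k i) ∧
      Cell mem (p + r / s + 2) g ∧ (y ≤ g → lower i) ∧ (g < y → upper i))
    (hL : 0 < L) (hLm : L ≤ 2 ^ m) (hlow : lower 0) (hup : upper L) :
    ∃ (τ : Config w S) (l : ℕ), HaltsWithin searchProg (13 * m + 11) (queryConfig mem (x, y)) τ ∧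
      τ.mem = mem ∧ (τ.reg 0).toNat = k l ∧ lower l ∧ upper (l + 1) := by
  have hinit : ∃ σ, run searchProg 6 (queryConfig mem (x, y)) = some σ ∧
      SearchState mem y r (B + 0) (B + L) σ := by
    refine ⟨(((((((queryConfig mem (x, y)).write 3 (BitVec.ofNat w 1)).write 2
      (BitVec.ofNat w (x + 1))).write 2 (BitVec.ofNat w r)).write 4 (BitVec.ofNat w B)).write 5
      (BitVec.ofNat w (B + L))).write 7 (BitVec.ofNat w 2)), ?_, ?_⟩
    · refine run_const rfl ?_
      refine run_op rfl (v := BitVec.ofNat w (x + 1)) ?_ ?_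
      · simp [BinOp.eval, Config.write, queryConfig, BitVec.ofNat_add]
      refine run_load rfl (a := x + 1) (v := r) ?_ hx ?_
      · simp [Config.write]
      refine run_load rfl (a := 0) (v := B) ?_ h0 ?_
      · simp [Config.write, queryConfig]
      refine run_load rfl (a := 1) (v := B + L) ?_ h1 ?_
      · simp [Config.write]
      exact run_const rfl rfl
    · constructor <;> simp [Config.write, queryConfig]
  obtain ⟨σ, hσ, hst⟩ := hinit
  obtain ⟨⟨pc, reg, mem'⟩, t, l, ht, hrun, hpc, hmem, h3, h4, hlL, hll, hul⟩ :=
    searchProg_loop hB hy hr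
      (fun i hi => by
        obtain ⟨p, s, g, h⟩ := hrow i hi
        exact ⟨p, s, g, h.1, h.2.1, h.2.2.2⟩) m 0 L σ hst hL le_rfl (by omega) hlow hup
  simp only at hpc hmem h3 h4
  subst hpc hmem
  obtain ⟨p, s, g, hp, -, hk, -⟩ := hrow l hlL
  have hfin : ∃ τ, run searchProg 3 ⟨21, reg, mem'⟩ = some τ ∧ τ.pc = 24 ∧ τ.mem = mem' ∧
      (τ.reg 0).toNat = k l := by
    refine ⟨((Config.write ⟨21, reg, mem'⟩ 9 (BitVec.ofNat w p)).write 9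
      (BitVec.ofNat w (p + 1))).write 0 (BitVec.ofNat w (k l)), ?_, ?_⟩
    · refine run_load rfl (a := B + l) (v := p) h4 hp ?_
      refine run_op rfl (v := BitVec.ofNat w (p + 1)) ?_ ?_
      · simp [BinOp.eval, Config.write, h3, BitVec.ofNat_add]
      refine run_load rfl (a := p + 1) (v := k l) ?_ hk rfl
      simp [Config.write]
    · simp [Config.write, Nat.mod_eq_of_lt hk.2.1]
  obtain ⟨τ, hτ, hτpc, hτmem, hτreg⟩ := hfin
  refine ⟨τ, l, ⟨⟨6 + t + 3, by omega, run_trans (run_trans hσ hrun) hτ⟩, ?_⟩, hτmem, hτreg,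
    hll, hul⟩
  rw [hτpc]; rfl

end WordRAM

/-! ### Approximate staircases. -/

namespace ApproxDominance

open Finset

/-- The number of points of `P` in the columns to the left of `x`. -/
def pointsLeft (P : Finset (ℕ × ℕ)) (x : ℕ) : ℕ :=
  (P.filter fun p => p.1 < x).card

theorem pointsLeft_le_card (P : Finset (ℕ × ℕ)) (x : ℕ) : pointsLeft P x ≤ P.card :=
  card_filter_le _ _

theorem dominanceCount_le_card (P : Finset (ℕ × ℕ)) (q : ℕ × ℕ) : dominanceCount P q ≤ P.card :=
  card_filter_le _ _

theorem dominanceCount_anti (P : Finset (ℕ × ℕ)) {x y y' : ℕ} (h : y ≤ y') :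
    dominanceCount P (x, y') ≤ dominanceCount P (x, y) := by
  refine card_le_card fun p hp => ?_
  obtain ⟨hP, hx, hy⟩ := mem_filter.1 hp
  exact mem_filter.2 ⟨hP, hx, h.trans hy⟩

theorem filter_lt_subset (P : Finset (ℕ × ℕ)) {x x' : ℕ} (h : x ≤ x') :
    (P.filter fun p => p.1 < x) ⊆ P.filter fun p => p.1 < x' := fun p hp => by
  obtain ⟨hP, hx⟩ := mem_filter.1 hp
  exact mem_filter.2 ⟨hP, hx.trans_le h⟩

/-- Points counted for `x'` but not for `x` lie in the columns from `x'` up to `x - 1`. If `x ≤ x'`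
there are none, in agreement with truncated subtraction. -/
theorem dominanceCount_le_add (P : Finset (ℕ × ℕ)) (x x' y : ℕ) :
    dominanceCount P (x', y) ≤ dominanceCount P (x, y) + (pointsLeft P x - pointsLeft P x') := by
  have hsub : (P.filter fun p => Dominates p (x', y)) ⊆
      (P.filter fun p => Dominates p (x, y)) ∪
        ((P.filter fun p => p.1 < x) \ (P.filter fun p => p.1 < x')) := by
    intro p hp
    simp only [mem_filter, mem_union, mem_sdiff] at hp ⊢
    simp only [Dominates] at hp ⊢
    by_cases h : x ≤ p.1
    · exact Or.inl ⟨hp.1, h, hp.2.2⟩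
    · exact Or.inr ⟨⟨hp.1, by omega⟩, fun h' => by omega⟩
  refine (card_le_card hsub).trans ((card_union_le _ _).trans ?_)
  refine Nat.add_le_add_left ?_ _
  rcases le_total x' x with h | h
  · rw [card_sdiff_of_subset (filter_lt_subset P h)]
    rfl
  · rw [sdiff_eq_empty_iff_subset.2 (filter_lt_subset P h)]
    simp

open Classical in
/-- The height of the approximate staircase of level `k` over the block `j`, where a block consists
of the columns `x` with the same value of `pointsLeft P x / s`. -/
noncomputable def stairHeight (n : ℕ) (P : Finset (ℕ × ℕ)) (k s j : ℕ) : ℕ :=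
  ((Icc 1 n).filter fun y => ∃ x, pointsLeft P x / s = j ∧
    k + s ≤ dominanceCount P (x, y) + 1).sup id

open Classical in
theorem stairHeight_le (n : ℕ) (P : Finset (ℕ × ℕ)) (k s j : ℕ) : stairHeight n P k s j ≤ n :=
  Finset.sup_le fun _ hy => (mem_Icc.1 (mem_filter.1 hy).1).2

open Classical in
-- Some column of the block has count at least `k + s - 1` at height `y`, and moving to `x` loses at
-- most `s - 1` points. For `s = 1` the staircase is exact.
theorem le_dominanceCount_of_le_stairHeight {n : ℕ} {P : Finset (ℕ × ℕ)} {k s x y : ℕ}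
    (hs : 0 < s) (hy : 1 ≤ y) (h : y ≤ stairHeight n P k s (pointsLeft P x / s)) :
    k ≤ dominanceCount P (x, y) := by
  -- Since `1 ≤ y`, the default height 0 of an empty supremum is excluded.
  obtain ⟨y', hy', hle⟩ := (Finset.le_sup_iff (f := id) (show (⊥ : ℕ) < y from hy)).1 h
  obtain ⟨-, x', hx', hk⟩ := mem_filter.1 hy'
  have h1 := dominanceCount_anti P (x := x') hle
  have h2 := dominanceCount_le_add P x x' y
  have h3 : pointsLeft P x < pointsLeft P x' + s := by
    have e1 := Nat.div_add_mod (pointsLeft P x) s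
    have e2 := Nat.div_add_mod (pointsLeft P x') s
    have e3 := Nat.mod_lt (pointsLeft P x) hs
    rw [hx'] at e2
    omega
  simp only [id] at h1
  omega

open Classical in
theorem dominanceCount_lt_of_stairHeight_lt {n : ℕ} {P : Finset (ℕ × ℕ)} {k s x y : ℕ}
    (hy : y ∈ Icc 1 n) (h : stairHeight n P k s (pointsLeft P x / s) < y) :
    dominanceCount P (x, y) + 2 ≤ k + s := by
  by_contra hc
  have : y ≤ stairHeight n P k s (pointsLeft P x / s) :=
    Finset.le_sup (f := id) (mem_filter.2 ⟨hy, x, rfl, by omega⟩)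
  omega

/-! ### The sequence of levels. -/

/-- The distance of level `i` from the next one: `K` consecutive levels for each power of two. -/
def gap (K i : ℕ) : ℕ := 2 ^ (i / K)

/-- The number of dominating points that level `i` stands for. -/
def level (K i : ℕ) : ℕ := ∑ t ∈ range i, gap K t

theorem gap_pos (K i : ℕ) : 0 < gap K i := by unfold gap; positivity

theorem level_succ (K i : ℕ) : level K (i + 1) = level K i + gap K i := sum_range_succ _ _

theorem sum_range_mul_div {K : ℕ} (hK : 0 < K) (f : ℕ → ℕ) (j : ℕ) :
    ∑ t ∈ range (K * j), f (t / K) = K * ∑ a ∈ range j, f a := by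
  induction j with
  | zero => simp
  | succ j ih =>
    rw [Nat.mul_succ, sum_range_add, ih, sum_range_succ, mul_add]
    congr 1
    rw [sum_congr rfl (g := fun _ => f j)]
    · simp
    · intro t ht
      rw [Nat.mul_add_div hK, Nat.div_eq_of_lt (mem_range.1 ht), add_zero]

theorem level_mul {K : ℕ} (hK : 0 < K) (j : ℕ) : level K (K * j) + K = K * 2 ^ j := by
  have h : level K (K * j) = K * ∑ a ∈ range j, 2 ^ a := sum_range_mul_div hK _ j
  rw [h, ← Nat.mul_succ, Nat.succ_eq_add_one, Nat.geomSum_eq le_rfl, Nat.div_one,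
    Nat.sub_add_cancel Nat.one_le_two_pow]

theorem level_mono (K : ℕ) : Monotone (level K) :=
  monotone_nat_of_le_succ fun i => by rw [level_succ]; omega

theorem level_of_le {K i : ℕ} (h : i ≤ K) : level K i = i := by
  unfold level
  rw [sum_congr rfl (g := fun _ => 1)]
  · simp
  · intro t ht
    rw [gap, Nat.div_eq_of_lt ((mem_range.1 ht).trans_le h), pow_zero]

/-- Gaps at most double from one level to the next, and a level is about `K` times its gap. The
slack `2 * K` is the most that `approxCount_level` tolerates: at `i = 0` it is attained, and it
forces small counts to be exact. -/
theorem gap_add_gap_le {K : ℕ} (hK : 2 ≤ K) (i : ℕ) :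
    K * (gap K i + gap K (i + 1)) ≤ 6 * level K i + 2 * K := by
  rcases lt_or_ge i K with hi | hi
  · rw [level_of_le hi.le]
    have h1 : gap K i = 1 := by rw [gap, Nat.div_eq_of_lt hi, pow_zero]
    rw [h1]
    rcases eq_or_lt_of_le (Nat.succ_le_of_lt hi) with h | h
    · have h2 : gap K (i + 1) = 2 := by
        rw [gap, show i + 1 = K from h, Nat.div_self (by omega), pow_one]
      rw [h2]; omega
    · have h2 : gap K (i + 1) = 1 := by rw [gap, Nat.div_eq_of_lt h, pow_zero]
      rw [h2]; omega
  · have h1 : gap K (i + 1) ≤ 2 * gap K i := by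
      rw [gap, gap, ← pow_succ']
      refine Nat.pow_le_pow_right (by norm_num) ?_
      rw [← Nat.add_div_right i (by omega : 0 < K)]
      exact Nat.div_le_div_right (by omega)
    have h2 : 2 ≤ gap K i := by
      rw [gap]
      exact Nat.le_self_pow (Nat.div_pos hi (by omega)).ne' 2
    have h3 : K * gap K i ≤ level K i + K := by
      rw [gap, ← level_mul (by omega : 0 < K)]
      exact Nat.add_le_add_right (level_mono K (Nat.mul_div_le i K)) K
    nlinarith

theorem sum_div_gap_le {K : ℕ} (hK : 0 < K) (n j : ℕ) :
    ∑ i ∈ range (K * j), n / gap K i ≤ K * (2 * n) := by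
  have h : ∑ i ∈ range (K * j), n / gap K i = K * ∑ a ∈ range j, n / 2 ^ a :=
    sum_range_mul_div hK (fun a => n / 2 ^ a) j
  rw [h]
  refine Nat.mul_le_mul_left _ ((Nat.geom_sum_le le_rfl n j).trans ?_)
  simp [mul_comm]

/-- The `+ 2` in `h₂` cancels the additive `2 * K` of `gap_add_gap_le`, leaving the purely relative
bound `K * (k - level K i) ≤ 6 * level K i`; hence a count of 0 and an output of 0 go together. -/
theorem approxCount_level {ε : ℝ} {K k i : ℕ} (hK : 2 ≤ K) (hε : 6 ≤ ε * K)
    (h₁ : level K i ≤ k) (h₂ : k + 2 ≤ level K (i + 1) + gap K (i + 1)) :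
    ApproxCount ε k (level K i) := by
  have h3 := gap_add_gap_le hK i
  rw [level_succ] at h₂
  have h4 : K * k ≤ K * level K i + 6 * level K i := by nlinarith
  have hK' : (0 : ℝ) < K := by exact_mod_cast (by omega : 0 < K)
  have h5 : (K * k : ℝ) ≤ K * level K i + 6 * level K i := by exact_mod_cast h4
  have h6 : (level K i : ℝ) ≤ k := by exact_mod_cast h₁
  have hk : (0 : ℝ) ≤ k := k.cast_nonneg
  have hε0 : 0 < ε := pos_of_mul_pos_left (by linarith) hK'.le
  constructor
  · have : (K : ℝ) * ((1 - ε) * k) ≤ K * level K i := by nlinarith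
    exact le_of_mul_le_mul_left this hK'
  · nlinarith

/-! ### Memory layout and assembly. -/

/-- Rows of given lengths stored one after the other. -/
theorem exists_rows (f : ℕ → ℕ → ℕ) (len : ℕ → ℕ) (N : ℕ) :
    ∃ M : ℕ → ℕ, ∀ i < N, ∀ j < len i, M (∑ t ∈ range i, len t + j) = f i j := by
  induction N with
  | zero => exact ⟨fun _ => 0, fun i hi => absurd hi (Nat.not_lt_zero i)⟩
  | succ N ih =>
    obtain ⟨M, hM⟩ := ih
    refine ⟨fun a => if a < ∑ t ∈ range N, len t then M a else f N (a - ∑ t ∈ range N, len t),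
      fun i hi j hj => ?_⟩
    rcases eq_or_lt_of_le (Nat.le_of_lt_succ hi) with rfl | hi
    · simp
    · have : ∑ t ∈ range i, len t + j < ∑ t ∈ range N, len t := by
        have h := sum_le_sum_of_subset (f := len) (range_mono (Nat.succ_le_of_lt hi))
        rw [sum_range_succ] at h
        omega
      simp only [if_pos this, hM i hi j hj]

/-- The lengths of the rows of the data structure with `L` levels: a header, the pointers to the
levels, and a row for each level. -/
def rowLength (n K L : ℕ) : ℕ → ℕ
  | 0 => n + 2
  | 1 => L
  | i + 2 => n / gap K i + 3

/-- The entries of the rows of the data structure with `L` levels. -/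
noncomputable def rowEntry (n : ℕ) (P : Finset (ℕ × ℕ)) (K L : ℕ) : ℕ → ℕ → ℕ
  | 0, 0 => n + 2
  | 0, 1 => n + 2 + L
  | 0, x + 2 => pointsLeft P (x + 1)
  | 1, i => ∑ t ∈ range (i + 2), rowLength n K L t
  | i + 2, 0 => gap K i
  | i + 2, 1 => level K i
  | i + 2, j + 2 => stairHeight n P (level K i) (gap K i) j

theorem sum_rowLength (n K L N : ℕ) :
    ∑ t ∈ range (N + 2), rowLength n K L t =
      ∑ i ∈ range N, n / gap K i + 3 * N + L + (n + 2) := by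
  rw [sum_range_succ', sum_range_succ']
  simp only [rowLength, sum_add_distrib, sum_const, card_range, smul_eq_mul]
  ring

theorem exists_rowMemory {w n K L : ℕ} (P : Finset (ℕ × ℕ)) :
    ∃ mem : Fin (∑ t ∈ range (L + 2), rowLength n K L t) → BitVec w,
      ∀ i < L + 2, ∀ j < rowLength n K L i,
        ∑ t ∈ range (L + 2), rowLength n K L t < 2 ^ w → rowEntry n P K L i j < 2 ^ w →
        WordRAM.Cell mem (∑ t ∈ range i, rowLength n K L t + j) (rowEntry n P K L i j) := by
  obtain ⟨M, hM⟩ := exists_rows (rowEntry n P K L) (rowLength n K L) (L + 2)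
  refine ⟨fun a => BitVec.ofNat w (M a), fun i hi j hj hS hw => ?_⟩
  have : ∑ t ∈ range i, rowLength n K L t + j < ∑ t ∈ range (L + 2), rowLength n K L t := by
    have h := sum_le_sum_of_subset (f := rowLength n K L) (range_mono (Nat.succ_le_of_lt hi))
    rw [sum_range_succ] at h
    omega
  exact ⟨this.trans hS, hw, this, by simp only [hM i hi j hj]⟩

theorem exists_dataStructure {ε : ℝ} {K n w : ℕ} (hK : 2 ≤ K) (hε : 6 ≤ ε * K) (hn : 1 ≤ n)
    (hw : 2 * ((6 * K + 3) * n) < 2 ^ w) {P : Finset (ℕ × ℕ)} (hP : P.card ≤ n) :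
    ∃ (S : ℕ) (mem : Fin S → BitVec w), S ≤ (6 * K + 3) * n ∧
      ∀ q ∈ grid n, ∃ τ : WordRAM.Config w S,
        WordRAM.HaltsWithin WordRAM.searchProg (13 * (K + Nat.log 2 (Nat.log 2 n) + 1) + 11)
          (WordRAM.queryConfig mem q) τ ∧
        τ.mem = mem ∧ ApproxCount ε (dominanceCount P q) (τ.reg 0).toNat := by
  have hlog : Nat.log 2 n + 1 ≤ n := Nat.log_lt_self 2 (by omega)
  obtain ⟨L, hL⟩ : ∃ L, L = K * (Nat.log 2 n + 1) := ⟨_, rfl⟩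
  have hLn : L ≤ K * n := hL ▸ Nat.mul_le_mul_left K hlog
  have hLpos : 0 < L := by rw [hL]; positivity
  have hsum : ∑ i ∈ range L, n / gap K i ≤ K * (2 * n) := hL ▸ sum_div_gap_le (by omega) n _
  have hlevel : level K L + K = K * 2 ^ (Nat.log 2 n + 1) := hL ▸ level_mul (by omega) _
  have hpow : 2 ^ Nat.log 2 n ≤ n := Nat.pow_log_le_self 2 (by omega)
  have hpow' : n < 2 ^ (Nat.log 2 n + 1) := Nat.lt_pow_succ_log_self (by norm_num) n
  have hlevelL : level K L ≤ 2 * (K * n) := by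
    rw [pow_succ] at hlevel
    have := Nat.mul_le_mul_left K hpow
    nlinarith
  have hnL : n < level K L := by nlinarith
  have hKn : n ≤ K * n := Nat.le_mul_of_pos_left n (by omega)
  have hSeq := sum_rowLength n K L L
  have hexp : (6 * K + 3) * n = 6 * (K * n) + 3 * n := by ring
  have hS : ∑ t ∈ range (L + 2), rowLength n K L t ≤ (6 * K + 3) * n := by
    rw [hSeq, hexp]
    have : K * (2 * n) = 2 * (K * n) := by ring
    omega
  obtain ⟨mem, hmem⟩ := exists_rowMemory (w := w) (n := n) (K := K) (L := L) P
  refine ⟨_, mem, hS, fun q hq => ?_⟩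
  obtain ⟨x, y⟩ := q
  obtain ⟨hx, hy⟩ := mem_product.1 hq
  simp only [mem_Icc] at hx hy
  have hcell := fun i hi j hj => hmem i hi j hj (by omega)
  have hptr (i : ℕ) (hi : i < L) :
      WordRAM.Cell mem (n + 2 + i) (∑ t ∈ range (i + 2), rowLength n K L t) := by
    have h := sum_le_sum_of_subset (f := rowLength n K L)
      (range_mono (show i + 2 ≤ L + 2 by omega))
    have := hcell 1 (by omega) i hi (by simp only [rowEntry]; omega)
    simpa [rowEntry, rowLength] using this
  have hr : pointsLeft P x ≤ n := (pointsLeft_le_card P x).trans hP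
  have hgap (i : ℕ) (hi : i < L) : gap K i ≤ n := by
    refine le_trans (Nat.pow_le_pow_right (by norm_num) ?_) hpow
    rw [hL] at hi
    exact Nat.le_of_lt_succ (Nat.div_lt_of_lt_mul hi)
  obtain ⟨τ, l, hτ, hτmem, hτreg, hlow, hup⟩ := WordRAM.searchProg_haltsWithin (mem := mem)
    (x := x) (y := y) (r := pointsLeft P x) (B := n + 2) (L := L)
    (m := K + Nat.log 2 (Nat.log 2 n) + 1) (k := level K)
    (lower := fun i => level K i ≤ dominanceCount P (x, y))
    (upper := fun i => dominanceCount P (x, y) + 2 ≤ level K i + gap K i)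
    (by omega) (by omega) (by omega)
    (by simpa [rowEntry] using hcell 0 (by omega) 0 (by simp [rowLength])
          (by simp only [rowEntry]; omega))
    (by simpa [rowEntry] using hcell 0 (by omega) 1 (by simp [rowLength])
          (by simp only [rowEntry]; omega))
    (by
      obtain ⟨x, rfl⟩ := Nat.exists_eq_add_of_le' hx.1
      simpa [rowEntry] using hcell 0 (by omega) (x + 2) (by simp only [rowLength]; omega)
        (by simp only [rowEntry]; omega))
    (fun i hi => by
      -- Two cells for gap and level, then one for each block index from 0 to `n / gap K i`.
      have hlen : rowLength n K L (i + 2) = n / gap K i + 3 := rfl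
      have hdiv : pointsLeft P x / gap K i ≤ n / gap K i := Nat.div_le_div_right hr
      have hst := stairHeight_le n P (level K i) (gap K i) (pointsLeft P x / gap K i)
      refine ⟨_, gap K i, stairHeight n P (level K i) (gap K i) (pointsLeft P x / gap K i), hptr i hi,
         ?_, ?_, ?_, fun h => ?_, fun h => ?_⟩
      · exact hcell (i + 2) (by omega) 0 (by simp [rowLength])
          (by have := hgap i hi; simp only [rowEntry]; omega)
      · exact hcell (i + 2) (by omega) 1 (by simp [rowLength])
          (by have := level_mono K hi.le; simp only [rowEntry]; omega)
      · exact hcell (i + 2) (by omega) (pointsLeft P x / gap K i + 2) (by omega)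
          (by simp only [rowEntry]; omega)
      · exact le_dominanceCount_of_le_stairHeight (gap_pos K i) hy.1 h
      · exact dominanceCount_lt_of_stairHeight_lt (mem_Icc.2 hy) h)
    hLpos
    (by
      -- The number of search rounds is the logarithm of `L = K * (log n + 1)`; the factor `K` is
      -- crudely charged `K` rounds.
      have h1 : K ≤ 2 ^ K := Nat.lt_two_pow_self.le
      have h2 : Nat.log 2 n + 1 ≤ 2 ^ (Nat.log 2 (Nat.log 2 n) + 1) :=
        Nat.lt_pow_succ_log_self (by norm_num) _
      rw [hL, add_assoc, pow_add]
      exact Nat.mul_le_mul h1 h2)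
    (by simp [level])
    -- The sentinel: no count exceeds `n`, and `n < level K L`.
    (by
      have := dominanceCount_le_card P (x, y)
      have := gap_pos K L
      show dominanceCount P (x, y) + 2 ≤ level K L + gap K L
      omega)
  exact ⟨τ, hτ, hτmem, hτreg ▸ approxCount_level hK hε hlow hup⟩

end ApproxDominance

theorem theorem3 (ε : ℝ) (hε : 0 < ε) :
    ∃ (prog : List WordRAM.Instr) (C c : ℕ),
      ∀ (n w : ℕ), Nat.log 2 n + c ≤ w →
        ∀ P : Finset (ℕ × ℕ), P ⊆ grid n → P.card ≤ n →
          ∃ (S : ℕ) (mem : Fin S → BitVec w), S ≤ C * n ∧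
            ∀ q ∈ grid n, ∃ τ : WordRAM.Config w S,
              WordRAM.HaltsWithin prog (C * (Nat.log 2 (Nat.log 2 n) + 1))
                (WordRAM.queryConfig mem q) τ ∧
              τ.mem = mem ∧
              ApproxCount ε (dominanceCount P q) (τ.reg 0).toNat := by
  obtain ⟨K, hK, hεK⟩ : ∃ K : ℕ, 2 ≤ K ∧ 6 ≤ ε * K := by
    refine ⟨⌈6 / ε⌉₊ + 2, by omega, ?_⟩
    have h := (div_le_iff₀' hε).1 (Nat.le_ceil (6 / ε))
    push_cast
    nlinarith
  -- With `ℓ` the iterated logarithm, `13 * (K + ℓ + 1) + 11 ≤ (13 * K + 24) * (ℓ + 1)`. The word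
  -- size lets sums of two addresses fit without overflow: `6 * K + 3` bits for the space factor,
  -- one for rounding the logarithm, one for the doubling.
  refine ⟨WordRAM.searchProg, 13 * K + 24, 6 * K + 5, fun n w hw P _ hP => ?_⟩
  rcases Nat.eq_zero_or_pos n with rfl | hn
  · exact ⟨0, Fin.elim0, by simp, fun q hq => by simp [grid] at hq⟩
  have hword : 2 * ((6 * K + 3) * n) < 2 ^ w := by
    have h1 : n < 2 ^ (Nat.log 2 n + 1) := Nat.lt_pow_succ_log_self (by norm_num) n
    have h2 : 6 * K + 3 < 2 ^ (6 * K + 3) := Nat.lt_two_pow_self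
    calc 2 * ((6 * K + 3) * n)
        < 2 * (2 ^ (6 * K + 3) * 2 ^ (Nat.log 2 n + 1)) := by
          have := Nat.mul_lt_mul_of_lt_of_le h2 h1.le (by positivity)
          omega
      _ = 2 ^ (Nat.log 2 n + (6 * K + 5)) := by ring
      _ ≤ 2 ^ w := Nat.pow_le_pow_right (by norm_num) hw
  obtain ⟨S, mem, hS, h⟩ := ApproxDominance.exists_dataStructure hK hεK hn hword hP
  refine ⟨S, mem, hS.trans (Nat.mul_le_mul_right n (by omega)), fun q hq => ?_⟩
  obtain ⟨τ, ⟨⟨t, ht, hrun⟩, hhalt⟩, hτ⟩ := h q hq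
  refine ⟨τ, ⟨⟨t, ht.trans ?_, hrun⟩, hhalt⟩, hτ⟩
  nlinarith [Nat.zero_le (K * Nat.log 2 (Nat.log 2 n))]
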